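/- Let $(\Omega,\mathcal F,\mathbb P)$ be a probability space and $N,n,m\ge 0$ integers. For an open-loop input sequence $U=(u(0),\dots,u(N-1))\in(\mathbb R^m)^N$ consider the linear system with random control matrix $$x(k+1)=A\,x(k)+B(k)\,u(k),\qquad 0\le k<N,$$ with $A\in\mathbb R^{n\times n}$, known $x(0)\in\mathbb R^n$ and random matrices $B(k)\in\mathbb R^{n\times m}$ all of whose entries have finite expectation and variance. Let $\mathcal U\subseteq\mathbb R^m$ be the set of admissible inputs, let $G_{ki}\in\mathbb R^{1\times n}$ and $h_{ki}\in\mathbb R$ $(1\le k\le N,\ 1\le i\le q_k)$ define the target half-spaces, let $\alpha<1/6$, and let $J:(\mathbb R^n)^N\times(\mathbb R^m)^N\to\mathbb R$ be the objective (no convexity of $\mathcal U$ or $J$ and no compactness of the target sets is needed). Problem 1: minimize $J(x(1),\dots,x(N),U)$ over $U\in\mathcal U^N$ subject to the dynamics and the joint chance constraint $$\mathbb P\Big(\bigcap_{k=1}^N\bigcap_{i=1}^{q_k}\{G_{ki}x(k)\le h_{ki}\}\Big)\ge 1-\alpha .$$ Reformulation 1: minimize the same objective over $U\in\mathcal U^N$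 and real numbers $\lambda_{ki}\ge 0$ subject to $$\mathbb E[G_{ki}x(k)]+\lambda_{ki}\,\mathrm{Std}(G_{ki}x(k))\le h_{ki}\ \text{ for all } k,i,\qquad \sum_{k=1}^N\sum_{i=1}^{q_k}\frac{4}{9(\lambda_{ki}^2+1)}\le\alpha ,$$ where the expectation and standard deviation are those induced by the dynamics. Let $(U,(\lambda_{ki}))$ be feasible for Reformulation 1, and suppose that under this $U$ every $G_{ki}x(k)$ has a unimodal distribution, i.e. for some $a\in\mathbb R$ its cumulative distribution function is convex on $(-\infty,a)$ and concave on $(a,\infty)$. Then $U$ is feasible for Problem 1, and it is a conservative solution of it: for every rule $\rho$ assigning an extended real number to a random cost (for instance its expectation), the optimal value of Problem 1, i.e. the infimum of $\rho(J(x(1),\dots,x(N),V))$ over all $V$ feasible for Problem 1, is at most $\rho(J(x(1),\dots,x(N),U))$. -/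

import Mathlib

open MeasureTheory ProbabilityTheory Matrix

noncomputable section

/-- A distribution on `ℝ` is unimodal if, for some `a`, its cumulative distribution function is
convex on `(-∞, a)` and concave on `(a, ∞)`. -/
def IsUnimodal (μ : Measure ℝ) : Prop :=
  ∃ a : ℝ, ConvexOn ℝ (Set.Iio a) (fun t => cdf μ t) ∧ ConcaveOn ℝ (Set.Ioi a) (fun t => cdf μ t)

/-- The data of the stochastic optimal control problem: state dimension `n`, input dimension `m`,
horizon `N`, outcome space `Ω`. The constraint index `k : Fin N` stands for the time `k + 1`, so
that `G k i`, `h k i` constrain the state at the times `1, …, N`. -/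
structure ControlProblem (n m N : ℕ) (Ω : Type*) where
  /-- the state matrix -/
  A : Matrix (Fin n) (Fin n) ℝ
  /-- the random control matrices at times `0, …, N - 1` -/
  B : Fin N → Ω → Matrix (Fin n) (Fin m) ℝ
  /-- the known initial state -/
  x₀ : Fin n → ℝ
  /-- the set of admissible inputs -/
  inputSet : Set (Fin m → ℝ)
  /-- the number of half-space constraints at each time -/
  q : Fin N → ℕ
  /-- the normals of the half-spaces -/
  G : (k : Fin N) → Fin (q k) → Fin n → ℝ
  /-- the right-hand sides of the half-space inequalities -/
  h : (k : Fin N) → Fin (q k) → ℝ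
  /-- the violation threshold -/
  α : ℝ
  /-- the performance objective, a function of the states at times `1, …, N` and of the inputs -/
  J : (Fin N → Fin n → ℝ) → (Fin N → Fin m → ℝ) → ℝ

namespace ControlProblem

variable {n m N : ℕ} {Ω : Type*}

/-- The random state at the times `0, …, N` under the open-loop input sequence `U`:
`x(0) = x₀` and `x(k+1) = A x(k) + B(k) u(k)`. -/
def state (S : ControlProblem n m N Ω) (U : Fin N → Fin m → ℝ) (k : Fin (N + 1)) (ω : Ω) :
    Fin n → ℝ :=
  Fin.induction (motive := fun _ => Fin n → ℝ) S.x₀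
    (fun j x => S.A *ᵥ x + S.B j ω *ᵥ U j) k

/-- The random variable `G_{ki} x(k)`, at the time `k + 1` for the index `k : Fin N`. -/
def output (S : ControlProblem n m N Ω) (U : Fin N → Fin m → ℝ) (k : Fin N) (i : Fin (S.q k))
    (ω : Ω) : ℝ :=
  S.G k i ⬝ᵥ S.state U k.succ ω

/-- The random cost `J(x(1), …, x(N), U)`. -/
def randomCost (S : ControlProblem n m N Ω) (U : Fin N → Fin m → ℝ) (ω : Ω) : ℝ :=
  S.J (fun k => S.state U k.succ ω) U

/-- Feasibility for the chance-constrained problem: the inputs are admissible, and the joint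
chance constraint holds for the states generated by the dynamics. -/
def Feasible [MeasurableSpace Ω] (S : ControlProblem n m N Ω) (P : Measure Ω)
    (U : Fin N → Fin m → ℝ) : Prop :=
  (∀ k, U k ∈ S.inputSet) ∧
    1 - S.α ≤ P.real {ω | ∀ (k : Fin N) (i : Fin (S.q k)), S.output U k i ω ≤ S.h k i}

/-- Feasibility for the deterministic reformulation: the inputs are admissible, the parameters
`lam` are nonnegative, the mean and standard deviation constraints hold, and the allocated risks
sum up to at most `α`. -/
def ReformFeasible [MeasurableSpace Ω] (S : ControlProblem n m N Ω) (P : Measure Ω)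
    (U : Fin N → Fin m → ℝ) (lam : (k : Fin N) → Fin (S.q k) → ℝ) : Prop :=
  (∀ k, U k ∈ S.inputSet) ∧
    (∀ k i, 0 ≤ lam k i) ∧
    (∀ k i, (∫ ω, S.output U k i ω ∂P) + lam k i * √(variance (S.output U k i) P) ≤ S.h k i) ∧
    ∑ k, ∑ i, 4 / (9 * (lam k i ^ 2 + 1)) ≤ S.α

/-- The optimal value of the chance-constrained problem, when `ρ` is the rule (such as the
expectation) that turns the random cost into the number to be minimized. It is `⊤` if the problem
is infeasible. -/
def optimalValue [MeasurableSpace Ω] (S : ControlProblem n m N Ω) (P : Measure Ω)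
    (ρ : (Ω → ℝ) → EReal) : EReal :=
  ⨅ (U : Fin N → Fin m → ℝ) (_ : S.Feasible P U), ρ (S.randomCost U)

end ControlProblem

end

/-! By Boole's inequality it suffices that each constraint fails with probability at most `4 / (9 *
(l ^ 2 + 1))`, which is the one-sided Vysochanskij–Petunin inequality
(`measureReal_mean_add_lt_le`). As in Cantelli's argument, it follows from a Gauss-type bound `4 * s
/ (9 * r ^ 2)` with `s` the second moment about a shifted centre. For that bound, the layer cake
formula bounds `s` below by integrals of the cdf `F`. Convexity left of the mode and a supergradient
line at `r` right of it replace `F` by affine functions, whose integrals are explicit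
(`sq_add_mul_le_of_supergradient`). The bound needs `8 * s ≤ 3 * r ^ 2`, that is `5 / 3 ≤ l ^ 2`; a
risk below `1 / 6` forces this. -/

/-! ### Affine and concave functions on the line. -/

/-- An affine function that is nonnegative on a left neighbourhood of `a` is nonnegative at `a`. -/
lemma affine_nonneg_of_forall_lt {u v b a : ℝ} (hba : b < a)
    (h : ∀ z, b < z → z < a → 0 ≤ u + v * z) : 0 ≤ u + v * a := by
  have hc : Filter.Tendsto (fun z => u + v * z) (nhdsWithin a (Set.Iio a)) (nhds (u + v * a)) :=
    ((by fun_prop : Continuous fun z => u + v * z).tendsto a).mono_left nhdsWithin_le_nhds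
  refine ge_of_tendsto hc ?_
  filter_upwards [Ioo_mem_nhdsLT hba] with z hz using h z hz.1 hz.2

/-- An affine function that is nonnegative on a right neighbourhood of `a` is nonnegative at `a`. -/
lemma affine_nonneg_of_forall_gt {u v b a : ℝ} (hab : a < b)
    (h : ∀ z, a < z → z < b → 0 ≤ u + v * z) : 0 ≤ u + v * a := by
  have hc : Filter.Tendsto (fun z => u + v * z) (nhdsWithin a (Set.Ioi a)) (nhds (u + v * a)) :=
    ((by fun_prop : Continuous fun z => u + v * z).tendsto a).mono_left nhdsWithin_le_nhds
  refine ge_of_tendsto hc ?_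
  filter_upwards [Ioo_mem_nhdsGT hab] with z hz using h z hz.1 hz.2

lemma integral_two_mul_mul_affine (u v x y : ℝ) :
    ∫ t in x..y, 2 * t * (u + v * t) = u * (y ^ 2 - x ^ 2) + 2 / 3 * v * (y ^ 3 - x ^ 3) := by
  have h : ∀ t ∈ Set.uIcc x y, HasDerivAt (fun t : ℝ => u * t ^ 2 + 2 / 3 * v * t ^ 3)
      (2 * t * (u + v * t)) t := by
    intro t _
    have h2 := ((hasDerivAt_pow 2 t).const_mul u).add ((hasDerivAt_pow 3 t).const_mul (2 / 3 * v))
    refine h2.congr_deriv ?_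
    norm_num
    ring
  rw [intervalIntegral.integral_eq_sub_of_hasDerivAt h
    ((by fun_prop : Continuous fun t : ℝ => 2 * t * (u + v * t)).intervalIntegrable _ _)]
  ring

/-- A concave function on `(a, ∞)` has a supergradient at each point. -/
lemma ConcaveOn.exists_supergradient {F : ℝ → ℝ} {a r : ℝ} (hF : ConcaveOn ℝ (Set.Ioi a) F)
    (har : a < r) : ∃ k, ∀ t, a < t → F t ≤ F r + k * (t - r) := by
  -- The supergradient is the supremum of the secant slopes to the right of `r`; every secant slope
  -- to the left bounds them above.
  let s : Set ℝ := (fun z => (F z - F r) / (z - r)) '' Set.Ioi r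
  have hub : ∀ y, a < y → y < r → (F r - F y) / (r - y) ∈ upperBounds s := by
    rintro y hay hyr _ ⟨z, hz, rfl⟩
    exact hF.slope_anti_adjacent hay (lt_trans har hz) hyr hz
  obtain ⟨y₀, hy₀, hy₀r⟩ := exists_between har
  have hbdd : BddAbove s := ⟨_, hub y₀ hy₀ hy₀r⟩
  have hne : s.Nonempty := ⟨_, r + 1, by simp, rfl⟩
  refine ⟨sSup s, fun t ht => ?_⟩
  rcases lt_trichotomy t r with h | h | h
  · have h1 := csSup_le hne (hub t ht h)
    rw [le_div_iff₀ (by linarith)] at h1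
    linarith
  · simp [h]
  · have h1 := le_csSup hbdd ⟨t, h, rfl⟩
    rw [div_le_iff₀ (by linarith)] at h1
    linarith

/-! ### Second-moment bounds for a convex-concave cdf. -/

section SecondMoment

variable {F : ℝ → ℝ}

lemma Monotone.intervalIntegrable_two_mul_mul_one_sub (hF : Monotone F) (x y : ℝ) :
    IntervalIntegrable (fun t => 2 * t * (1 - F t)) volume x y :=
  (intervalIntegrable_const.sub hF.intervalIntegrable).continuousOn_mul (by fun_prop)

lemma Monotone.intervalIntegrable_two_mul_mul_comp_neg (hF : Monotone F) (x y : ℝ) :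
    IntervalIntegrable (fun t => 2 * t * F (-t)) volume x y :=
  (Antitone.intervalIntegrable fun _ _ h => hF (neg_le_neg h)).continuousOn_mul (by fun_prop)

/-- If `F` is convex on `(-∞, a)` and at most `B` there, then the part of the second moment coming
from the values below `a` is minimal for the uniform distribution on `[-a / 2, a]`. -/
lemma sq_mul_le_integral_of_convexOn (hF : Monotone F) {a B : ℝ} (ha : 0 ≤ a)
    (hconv : 0 < a → ConvexOn ℝ (Set.Iio a) F) (hB : ∀ t < a, F t ≤ B) :
    a ^ 2 * (1 - 3 / 4 * B) ≤
      (∫ t in (0 : ℝ)..a, 2 * t * (1 - F t)) + ∫ t in (0 : ℝ)..(a / 2), 2 * t * F (-t) := by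
  rcases ha.eq_or_lt with rfl | ha
  · simp
  have hc := hconv ha
  -- The line through `(0, F 0)` and `(a, B)` lies above `F` on `(0, a)` and below it on the
  -- negative axis. As `a` is outside the domain of convexity, chords end at `z < a` and then `z →
  -- a`.
  have h1 : ∀ t ∈ Set.Ioo 0 a, 1 - F 0 + -((B - F 0) / a) * t ≤ 1 - F t := by
    intro t ht
    have := affine_nonneg_of_forall_lt (u := - t * F 0 + t * B) (v := F 0 - F t) ht.2
      (fun z hz hza => by
        have h := hc.secant_mono_aux1 (x := 0) (y := t) (z := z) ha hza ht.1 hz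
        nlinarith [mul_le_mul_of_nonneg_left (hB z hza) ht.1.le])
    have h2 : (F t - F 0) ≤ (B - F 0) / a * t := by
      rw [div_mul_eq_mul_div, le_div_iff₀ ha]; linarith
    linarith
  have h2 : ∀ t ∈ Set.Ioo 0 (a / 2), F 0 + -((B - F 0) / a) * t ≤ F (-t) := by
    intro t ht
    have := affine_nonneg_of_forall_lt (u := t * B - t * F 0) (v := F (-t) - F 0) ha
      (fun z hz hza => by
        have h := hc.secant_mono_aux1 (x := -t) (y := 0) (z := z)
          (show -t < a by linarith [ht.1]) hza (by linarith [ht.1]) hz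
        nlinarith [mul_le_mul_of_nonneg_left (hB z hza) ht.1.le])
    have h2 : (F 0 - F (-t)) ≤ (B - F 0) / a * t := by
      rw [div_mul_eq_mul_div, le_div_iff₀ ha]; linarith
    linarith
  have i1 := intervalIntegral.integral_mono_on_of_le_Ioo ha.le
    ((by fun_prop : Continuous fun t : ℝ =>
      2 * t * (1 - F 0 + -((B - F 0) / a) * t)).intervalIntegrable 0 a)
    (hF.intervalIntegrable_two_mul_mul_one_sub 0 a)
    (fun t ht => mul_le_mul_of_nonneg_left (h1 t ht) (by linarith [ht.1]))
  have i2 := intervalIntegral.integral_mono_on_of_le_Ioo (half_pos ha).le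
    ((by fun_prop : Continuous fun t : ℝ =>
      2 * t * (F 0 + -((B - F 0) / a) * t)).intervalIntegrable 0 (a / 2))
    (hF.intervalIntegrable_two_mul_mul_comp_neg 0 (a / 2))
    (fun t ht => mul_le_mul_of_nonneg_left (h2 t ht) (by linarith [ht.1]))
  rw [integral_two_mul_mul_affine] at i1 i2
  -- The cutoff `a / 2` is the one for which `F 0` cancels.
  refine le_trans (le_of_eq ?_) (add_le_add i1 i2)
  field_simp
  ring

/-- Key estimate: `F` lies below the line of slope `k` through `(r, F r)` on `(a, M)`, and below
the value of this line at `a` on `(-∞, a)`. -/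
lemma sq_add_mul_le_of_supergradient (hF : Monotone F) (h0 : ∀ t, 0 ≤ F t) {a r k s : ℝ}
    (ha : 0 ≤ a) (har : a ≤ r) (hr : 0 < r) (hk : 0 ≤ k)
    (hs : ∀ M, 0 ≤ M →
      (∫ t in (0 : ℝ)..M, 2 * t * (1 - F t)) + ∫ t in (0 : ℝ)..M, 2 * t * F (-t) ≤ s)
    (hconv : 0 < a → ConvexOn ℝ (Set.Iio a) F)
    (hleft : ∀ t < a, F t ≤ F r + k * (a - r))
    (hright : a < r → ∀ t, a < t → F t ≤ F r + k * (t - r)) :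
    a ^ 2 + (1 - F r) * (9 * r ^ 2 - 6 * a ^ 2) ≤ 4 * s := by
  -- This `M` makes the coefficient of `1 - F r` equal to `9 * r ^ 2 - 6 * a ^ 2`; for `a = 0` it is
  -- `3 * r / 2`.
  obtain ⟨M, hM0, hM⟩ : ∃ M, 0 ≤ M ∧ 4 * M ^ 2 = 9 * r ^ 2 - 5 * a ^ 2 := by
    refine ⟨√((9 * r ^ 2 - 5 * a ^ 2) / 4), Real.sqrt_nonneg _, ?_⟩
    rw [Real.sq_sqrt (by nlinarith)]
    ring
  have hrM : r ≤ M := by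
    by_contra! h
    nlinarith
  have hleft' := sq_mul_le_integral_of_convexOn hF ha hconv hleft
  have hneg : ∫ t in (0 : ℝ)..(a / 2), 2 * t * F (-t) ≤ ∫ t in (0 : ℝ)..M, 2 * t * F (-t) := by
    rw [← intervalIntegral.integral_add_adjacent_intervals
      (hF.intervalIntegrable_two_mul_mul_comp_neg 0 (a / 2))
      (hF.intervalIntegrable_two_mul_mul_comp_neg (a / 2) M)]
    have : 0 ≤ ∫ t in (a / 2)..M, 2 * t * F (-t) :=
      intervalIntegral.integral_nonneg (by linarith) fun t ht =>
        mul_nonneg (by linarith [ht.1]) (h0 _)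
    linarith
  have hsplit := intervalIntegral.integral_add_adjacent_intervals
    (hF.intervalIntegrable_two_mul_mul_one_sub 0 a) (hF.intervalIntegrable_two_mul_mul_one_sub a M)
  have hsM := hs M hM0
  rcases har.eq_or_lt with rfl | har
  · have hMa : M = a := by nlinarith
    subst hMa
    simp only [intervalIntegral.integral_same] at hsplit
    nlinarith
  have i1 := intervalIntegral.integral_mono_on_of_le_Ioo (har.le.trans hrM)
    ((by fun_prop : Continuous fun t : ℝ =>
      2 * t * (1 - F r + k * r + -k * t)).intervalIntegrable a M)
    (hF.intervalIntegrable_two_mul_mul_one_sub a M)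
    (fun t ht => mul_le_mul_of_nonneg_left
      (show _ ≤ 1 - F t by linarith [hright har t ht.1]) (by linarith [ht.1]))
  rw [integral_two_mul_mul_affine] at i1
  -- Three times the coefficient of `k` in four times the lower bound for `s`. Multiplying by `3 * r
  -- + 2 * M` turns `3 * r - 2 * M` into `5 * a ^ 2`, so `a ^ 2` factors out.
  have hcoef : 0 ≤ 12 * r * M ^ 2 - 8 * M ^ 3 - 3 * a ^ 2 * r - a ^ 3 := by
    have e : (12 * r * M ^ 2 - 8 * M ^ 3 - 3 * a ^ 2 * r - a ^ 3) * (3 * r + 2 * M) =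
        a ^ 2 * (20 * M ^ 2 - (3 * r + a) * (3 * r + 2 * M)) := by
      linear_combination (-4 * M ^ 2) * hM
    have e2 : 0 ≤ 20 * M ^ 2 - (3 * r + a) * (3 * r + 2 * M) := by nlinarith
    have e3 : 0 < 3 * r + 2 * M := by linarith
    exact nonneg_of_mul_nonneg_left (e ▸ mul_nonneg (sq_nonneg a) e2) e3
  have hkc := mul_nonneg hk hcoef
  linear_combination 4 * hsM + 4 * hneg + 4 * hleft' + 4 * i1 + 4 * hsplit + hkc / 3
    - (1 - F r) * hM

/-- Analytic form of the one-sided inequality for unimodal distributions. -/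
lemma one_sub_le_of_unimodal (hF : Monotone F) (h0 : ∀ t, 0 ≤ F t) {a r s : ℝ} (hr : 0 < r)
    (hs : ∀ M, 0 ≤ M →
      (∫ t in (0 : ℝ)..M, 2 * t * (1 - F t)) + ∫ t in (0 : ℝ)..M, 2 * t * F (-t) ≤ s)
    (hconv : ConvexOn ℝ (Set.Iio a) F) (hconc : ConcaveOn ℝ (Set.Ioi a) F)
    (hsr : 8 * s ≤ 3 * r ^ 2) : 1 - F r ≤ 4 * s / (9 * r ^ 2) := by
  -- Solving for `1 - F r` gives at most `(4 * s - b ^ 2) / (9 * r ^ 2 - 6 * b ^ 2)`, and `8 * s ≤ 3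
  -- * r ^ 2` is what makes `b = 0` the worst case.
  suffices h : ∃ b, 0 ≤ b ∧ b ≤ r ∧ b ^ 2 + (1 - F r) * (9 * r ^ 2 - 6 * b ^ 2) ≤ 4 * s by
    obtain ⟨b, hb, hbr, h⟩ := h
    have hpos : 0 < 9 * r ^ 2 - 6 * b ^ 2 := by nlinarith
    rw [le_div_iff₀ (by positivity)]
    refine le_of_mul_le_mul_right ?_ hpos
    have := mul_le_mul_of_nonneg_left hsr (sq_nonneg b)
    nlinarith [mul_le_mul_of_nonneg_left h (sq_nonneg r)]
  rcases le_or_gt r a with hra | har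
  -- With the mode at or beyond `r`, only convexity below `r` is used, and the line is horizontal.
  · refine ⟨r, hr.le, le_rfl, sq_add_mul_le_of_supergradient (k := 0) hF h0 hr.le le_rfl hr le_rfl
      hs (fun _ => hconv.subset (Set.Iio_subset_Iio hra) (convex_Iio r)) (fun t ht => ?_)
      fun h => absurd h (lt_irrefl r)⟩
    simpa using hF ht.le
  obtain ⟨k, hk⟩ := hconc.exists_supergradient har
  have hk0 : 0 ≤ k := by
    have := hk (r + 1) (by linarith)
    have := hF (show r ≤ r + 1 by linarith)
    linarith
  -- A negative mode is replaced by `0`, where no convexity is required.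
  have har' : max a 0 < r := max_lt har hr
  refine ⟨max a 0, le_max_right _ _, har'.le, sq_add_mul_le_of_supergradient hF h0
    (le_max_right _ _) har'.le hr hk0 hs (fun h => ?_) (fun t ht => ?_)
    fun _ t ht => hk t ((le_max_left _ _).trans_lt ht)⟩
  · rcases lt_max_iff.1 h with h | h
    · rwa [max_eq_left h.le]
    · exact absurd h (lt_irrefl 0)
  · have := affine_nonneg_of_forall_gt (u := F r - k * r - F t) (v := k) har' fun z hz _ => by
      linarith [hk z ((le_max_left _ _).trans_lt hz), hF (ht.trans hz).le]
    linarith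

end SecondMoment

/-! ### Tail inequalities for unimodal random variables. -/

section Tail

variable {Ω : Type*} [MeasurableSpace Ω] {P : Measure Ω} [IsProbabilityMeasure P] {X : Ω → ℝ}

/-- The events `t < X` and `X ≤ -t` are disjoint for `t > 0`; this feeds the layer cake formula for
`|X|`. -/
lemma one_sub_add_le_measureReal_le_abs (hX : AEMeasurable X P) {t : ℝ} (ht : 0 < t) :
    1 - P.real {ω | X ω ≤ t} + P.real {ω | X ω ≤ -t} ≤ P.real {ω | t ≤ |X ω|} := by
  have hm : NullMeasurableSet {ω | X ω ≤ t} P := nullMeasurableSet_le hX aemeasurable_const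
  have h := measureReal_union_add_inter₀ (s := {ω | t ≤ |X ω|}) hm
  have hu : {ω | t ≤ |X ω|} ∪ {ω | X ω ≤ t} = Set.univ := by
    ext ω
    simp only [Set.mem_union, Set.mem_ofPred_eq, Set.mem_univ, iff_true, le_abs]
    rcases le_total (X ω) t with h | h <;> simp [h]
  have hi : P.real {ω | X ω ≤ -t} ≤ P.real ({ω | t ≤ |X ω|} ∩ {ω | X ω ≤ t}) := by
    refine measureReal_mono fun ω (hω : X ω ≤ -t) => ⟨?_, ?_⟩
    · exact le_abs.2 (Or.inr (le_neg_of_le_neg hω))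
    · exact hω.trans (by linarith)
  rw [hu, probReal_univ] at h
  linarith

lemma monotone_measureReal_le : Monotone fun t => P.real {ω | X ω ≤ t} :=
  fun _ _ hst => measureReal_mono fun _ hω => le_trans hω hst

/-- Layer cake lower bound for the second moment. -/
lemma integral_two_mul_mul_measureReal_le (hX : MemLp X 2 P) {M : ℝ} (hM : 0 ≤ M) :
    (∫ t in (0 : ℝ)..M, 2 * t * (1 - P.real {ω | X ω ≤ t})) +
      ∫ t in (0 : ℝ)..M, 2 * t * P.real {ω | X ω ≤ -t} ≤ ∫ ω, X ω ^ 2 ∂P := by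
  have hmono : Monotone fun t => P.real {ω | X ω ≤ t} := monotone_measureReal_le
  have i1 := hmono.intervalIntegrable_two_mul_mul_one_sub 0 M
  have i2 := hmono.intervalIntegrable_two_mul_mul_comp_neg 0 M
  have hXm : AEMeasurable X P := hX.aestronglyMeasurable.aemeasurable
  rw [← intervalIntegral.integral_add i1 i2, intervalIntegral.integral_of_le hM]
  have hint := (i1.add i2).1
  have hnn : ∀ᵐ t ∂(volume.restrict (Set.Ioc 0 M)),
      0 ≤ 2 * t * (1 - P.real {ω | X ω ≤ t}) + 2 * t * P.real {ω | X ω ≤ -t} := by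
    filter_upwards [self_mem_ae_restrict measurableSet_Ioc] with t ht
    have h1 : P.real {ω | X ω ≤ t} ≤ 1 := measureReal_le_one
    have h2 := ht.1.le
    exact add_nonneg (mul_nonneg (by linarith) (by linarith))
      (mul_nonneg (by linarith) measureReal_nonneg)
  rw [← ENNReal.ofReal_le_ofReal_iff (integral_nonneg fun ω => sq_nonneg _),
    ofReal_integral_eq_lintegral_ofReal hint hnn,
    ofReal_integral_eq_lintegral_ofReal hX.integrable_sq (ae_of_all _ fun ω => sq_nonneg _)]
  have key := lintegral_rpow_eq_lintegral_meas_le_mul P (f := fun ω => |X ω|)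
    (ae_of_all _ fun ω => abs_nonneg _) (by fun_prop) (p := 2) (by norm_num)
  simp only [Real.rpow_ofNat, sq_abs] at key
  rw [key, ← lintegral_const_mul' _ _ ENNReal.ofReal_ne_top]
  refine le_trans ?_ (lintegral_mono_set (Set.Ioc_subset_Ioi_self (a := M) (b := 0)))
  refine setLIntegral_mono' measurableSet_Ioc fun t ht => ?_
  have h := one_sub_add_le_measureReal_le_abs hXm ht.1
  rw [← ofReal_measureReal, ← ENNReal.ofReal_mul measureReal_nonneg,
    ← ENNReal.ofReal_mul (by norm_num)]
  refine ENNReal.ofReal_le_ofReal ?_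
  norm_num
  nlinarith [ht.1, mul_le_mul_of_nonneg_left h ht.1.le]

lemma integral_sub_sq_eq_variance_add (hX : MemLp X 2 P) (c : ℝ) :
    ∫ ω, (X ω - c) ^ 2 ∂P = variance X P + (∫ ω, X ω ∂P - c) ^ 2 := by
  have hint : Integrable X P := hX.integrable (by norm_num)
  have h := variance_eq_sub (hX.sub (memLp_const c))
  have h2 : variance (X - fun _ : Ω => c) P = variance X P :=
    variance_sub_const hX.aestronglyMeasurable c
  rw [h2] at h
  have h3 : ∫ ω, (X - fun _ : Ω => c) ω ∂P = ∫ ω, X ω ∂P - c := by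
    simp only [Pi.sub_apply]
    rw [integral_sub hint (integrable_const c)]
    simp
  rw [h3] at h
  simp only [Pi.pow_apply, Pi.sub_apply] at h
  linarith

lemma measureReal_lt_eq_one_sub (hX : AEMeasurable X P) (t : ℝ) :
    P.real {ω | t < X ω} = 1 - P.real {ω | X ω ≤ t} := by
  have hm : NullMeasurableSet {ω | X ω ≤ t} P := nullMeasurableSet_le hX aemeasurable_const
  rw [← probReal_compl_eq_one_sub₀ hm]
  congr 1
  ext ω
  simp

/-- One-sided Gauss inequality about an arbitrary centre `c`. -/
lemma measureReal_lt_le_of_isUnimodal_map (hX : MemLp X 2 P) (hu : IsUnimodal (P.map X))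
    {c r : ℝ} (hr : 0 < r) (hs : 8 * ∫ ω, (X ω - c) ^ 2 ∂P ≤ 3 * r ^ 2) :
    P.real {ω | c + r < X ω} ≤ 4 * (∫ ω, (X ω - c) ^ 2 ∂P) / (9 * r ^ 2) := by
  obtain ⟨a, hconv, hconc⟩ := hu
  have hXm : AEMeasurable X P := hX.aestronglyMeasurable.aemeasurable
  have := Measure.isProbabilityMeasure_map hXm
  have hY : MemLp (fun ω => X ω - c) 2 P := hX.sub (memLp_const c)
  have hcdf : ∀ t, P.real {ω | X ω - c ≤ t} = cdf (P.map X) (c + t) := by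
    intro t
    rw [cdf_eq_real, map_measureReal_apply_of_aemeasurable hXm measurableSet_Iic]
    congr 1
    ext ω
    simp [add_comm]
  have hfun : (fun t => cdf (P.map X) t) ∘ (fun z => c + z) =
      fun t => P.real {ω | X ω - c ≤ t} := funext fun t => (hcdf t).symm
  have h1 := hconv.translate_right c
  have h2 := hconc.translate_right c
  rw [hfun] at h1 h2
  have e1 : (fun z => c + z) ⁻¹' Set.Iio a = Set.Iio (a - c) := by simp
  have e2 : (fun z => c + z) ⁻¹' Set.Ioi a = Set.Ioi (a - c) := by simp
  rw [e1] at h1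
  rw [e2] at h2
  have := one_sub_le_of_unimodal monotone_measureReal_le (fun _ => measureReal_nonneg) hr
    (fun M hM => integral_two_mul_mul_measureReal_le hY hM) h1 h2 hs
  rw [← measureReal_lt_eq_one_sub hY.aestronglyMeasurable.aemeasurable] at this
  refine le_trans (le_of_eq ?_) this
  congr 1
  ext ω
  simp [lt_sub_iff_add_lt, add_comm]

/-- One-sided Vysochanskij–Petunin inequality. -/
theorem measureReal_mean_add_lt_le (hX : MemLp X 2 P) (hu : IsUnimodal (P.map X))
    {l : ℝ} (hl : 0 ≤ l) (hl2 : 5 / 3 ≤ l ^ 2) :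
    P.real {ω | (∫ ω, X ω ∂P) + l * √(variance X P) < X ω} ≤ 4 / (9 * (l ^ 2 + 1)) := by
  have hlpos : 0 < l := by
    rcases hl.eq_or_lt with rfl | h
    · norm_num at hl2
    · exact h
  rcases (variance_nonneg X P).eq_or_lt with h0 | hpos
  · have hae := ae_eq_integral_of_variance_eq_zero hX h0.symm
    have : P.real {ω | (∫ ω, X ω ∂P) + l * √(variance X P) < X ω} = 0 := by
      rw [measureReal_eq_zero_iff]
      refine measure_mono_null (fun ω hω => ?_) hae
      have h : (∫ ω, X ω ∂P) + l * √(variance X P) < X ω := hω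
      rw [← h0, Real.sqrt_zero, mul_zero, add_zero] at h
      exact h.ne'
    rw [this]
    positivity
  set σ := √(variance X P) with hσ
  have hσpos : 0 < σ := Real.sqrt_pos.2 hpos
  have hσ2 : σ ^ 2 = variance X P := Real.sq_sqrt hpos.le
  -- Among the centres `mean - y` with `r = l * σ + y`, the ratio `(σ ^ 2 + y ^ 2) / r ^ 2` is
  -- smallest at `y = σ / l`, with value `1 / (l ^ 2 + 1)`.
  have hs : ∫ ω, (X ω - ((∫ ω, X ω ∂P) - σ / l)) ^ 2 ∂P = (l * σ + σ / l) ^ 2 / (l ^ 2 + 1) := by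
    rw [integral_sub_sq_eq_variance_add hX, ← hσ2]
    field_simp
    ring
  have h := measureReal_lt_le_of_isUnimodal_map hX hu (c := (∫ ω, X ω ∂P) - σ / l)
    (r := l * σ + σ / l) (by positivity) (by
      rw [hs, ← mul_div_assoc, div_le_iff₀ (by positivity)]
      nlinarith [sq_nonneg (l * σ + σ / l)])
  have hc : (∫ ω, X ω ∂P) - σ / l + (l * σ + σ / l) = (∫ ω, X ω ∂P) + l * σ := by ring
  rw [hs, hc] at h
  refine h.trans (le_of_eq ?_)
  have : l * σ + σ / l ≠ 0 := by positivity
  field_simp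

end Tail

/-! ### Square integrability of states and outputs. -/

namespace ControlProblem

variable {n m N : ℕ} {Ω : Type*} [MeasurableSpace Ω] {P : Measure Ω} [IsFiniteMeasure P]
  {S : ControlProblem n m N Ω}

lemma memLp_state (hB : ∀ (k : Fin N) (a : Fin n) (b : Fin m), MemLp (fun ω => S.B k ω a b) 2 P)
    (U : Fin N → Fin m → ℝ) (k : Fin (N + 1)) (a : Fin n) :
    MemLp (fun ω => S.state U k ω a) 2 P := by
  induction k using Fin.induction generalizing a with
  | zero => exact memLp_const (S.x₀ a)
  | succ k ih =>
    have h : (fun ω => S.state U k.succ ω a) = fun ω =>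
        (∑ j, S.A a j * S.state U k.castSucc ω j) + ∑ b, S.B k ω a b * U k b := rfl
    rw [h]
    exact (memLp_finsetSum _ fun j _ => (ih j).const_mul _).add
      (memLp_finsetSum _ fun b _ => (hB k a b).mul_const _)

lemma memLp_output (hB : ∀ (k : Fin N) (a : Fin n) (b : Fin m), MemLp (fun ω => S.B k ω a b) 2 P)
    (U : Fin N → Fin m → ℝ) (k : Fin N) (i : Fin (S.q k)) : MemLp (S.output U k i) 2 P :=
  memLp_finsetSum Finset.univ fun a _ => (memLp_state hB U k.succ a).const_mul (S.G k i a)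

end ControlProblem

/-! ### Union bound and conclusion. -/

/-- Boole's inequality for the joint event of finitely many constraints. -/
lemma one_sub_sum_le_measureReal_forall_le {Ω ι : Type*} [MeasurableSpace Ω] [Fintype ι]
    (P : Measure Ω) [IsProbabilityMeasure P] (Y : ι → Ω → ℝ) (h : ι → ℝ) :
    1 - ∑ i, P.real {ω | h i < Y i ω} ≤ P.real {ω | ∀ i, Y i ω ≤ h i} := by
  have hu : (Set.univ : Set Ω) = {ω | ∀ i, Y i ω ≤ h i} ∪ ⋃ i, {ω | h i < Y i ω} := by
    ext ω
    simp only [Set.mem_univ, Set.mem_union, Set.mem_ofPred_eq, Set.mem_iUnion, true_iff]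
    by_contra! hc
    obtain ⟨⟨i, hi⟩, hall⟩ := hc
    exact absurd hi (not_lt.2 (hall i))
  have h1 := measureReal_union_le (μ := P) {ω | ∀ i, Y i ω ≤ h i} (⋃ i, {ω | h i < Y i ω})
  have h2 := measureReal_iUnion_fintype_le (μ := P) fun i => {ω | h i < Y i ω}
  rw [← hu, probReal_univ] at h1
  linarith

theorem lemma2 {n m N : ℕ} {Ω : Type*} [MeasurableSpace Ω] (P : Measure Ω) [IsProbabilityMeasure P]
    (S : ControlProblem n m N Ω) (hα : S.α < 1 / 6)
    (hmoment : ∀ (k : Fin N) (a : Fin n) (b : Fin m), MemLp (fun ω => S.B k ω a b) 2 P)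
    (U : Fin N → Fin m → ℝ)
    (hunimodal : ∀ (k : Fin N) (i : Fin (S.q k)), IsUnimodal (P.map (S.output U k i)))
    (lam : (k : Fin N) → Fin (S.q k) → ℝ)
    (hfeas : S.ReformFeasible P U lam) :
    S.Feasible P U ∧ ∀ ρ : (Ω → ℝ) → EReal, S.optimalValue P ρ ≤ ρ (S.randomCost U) := by
  suffices hU : S.Feasible P U from ⟨hU, fun ρ => iInf₂_le U hU⟩
  obtain ⟨hadm, hlam, hmean, hrisk⟩ := hfeas
  refine ⟨hadm, ?_⟩
  have hnn : ∀ k i, 0 ≤ 4 / (9 * (lam k i ^ 2 + 1)) := fun k i => by positivity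
  -- Each single risk is at most the total, hence below `1 / 6`, and `4 / (9 * (8 / 3)) = 1 / 6`.
  have hterm : ∀ k i, 5 / 3 ≤ lam k i ^ 2 := by
    intro k i
    have h1 := Finset.single_le_sum (fun j _ => hnn k j) (Finset.mem_univ i)
    have h2 := Finset.single_le_sum (f := fun k => ∑ i, 4 / (9 * (lam k i ^ 2 + 1)))
      (fun k _ => Finset.sum_nonneg fun j _ => hnn k j) (Finset.mem_univ k)
    have h3 : 4 / (9 * (lam k i ^ 2 + 1)) < 1 / 6 :=
      (h1.trans (h2.trans hrisk)).trans_lt hα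
    rw [div_lt_div_iff₀ (by positivity) (by norm_num)] at h3
    linarith
  have htail : ∀ k i, P.real {ω | S.h k i < S.output U k i ω} ≤ 4 / (9 * (lam k i ^ 2 + 1)) :=
    fun k i => (measureReal_mono fun ω hω => (hmean k i).trans_lt hω).trans
      (measureReal_mean_add_lt_le (ControlProblem.memLp_output hmoment U k i) (hunimodal k i)
        (hlam k i) (hterm k i))
  have hboole := one_sub_sum_le_measureReal_forall_le P
    (fun j : (k : Fin N) × Fin (S.q k) => S.output U j.1 j.2) fun j => S.h j.1 j.2
  simp only [Sigma.forall, Fintype.sum_sigma] at hboole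
  have hsum := Finset.sum_le_sum fun k (_ : k ∈ Finset.univ) =>
    Finset.sum_le_sum fun i (_ : i ∈ Finset.univ) => htail k i
  linarith
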